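/- Let $\mathsf{T}$ be the rooted binary tree, whose vertices are the finite words over $\{0,1\}$, and let $\partial\mathsf{T}=\{0,1\}^{\mathbb{N}}$ be its boundary with the product topology. The \emph{Basilica group} $\mathfrak{B}$ is the group of automorphisms of $\mathsf{T}$ generated by $a=(1,b)$ and $b=(1,a)\varepsilon$, where $\varepsilon$ exchanges the two subtrees of the root; that is, $a$ and $b$ fix the root and, for every word $w$, $$a(0w)=0w,\quad a(1w)=1\,b(w),\qquad b(0w)=1w,\quad b(1w)=0\,a(w).$$ It acts on $\partial\mathsf{T}$. Let $\mathrm{Sub}(\mathfrak{B})$ be the space of subgroups of $\mathfrak{B}$ with the Chabauty topology (the topology induced from $\{0,1\}^{\mathfrak{B}}$). An \emph{invariant random subgroup} (IRS) of $\mathfrak{B}$ is a Borel probability measure on $\mathrm{Sub}(\mathfrak{B})$ that is invariant under conjugation by $\mathfrak{B}$; it is \emph{ergodic} if it is ergodic for the conjugation action. For $H\le\mathfrak{B}$ let $\mathrm{Fix}(H)=\{x\in\partial\mathsf{T} : h(x)=x \text{ for all } h\in H\}$. Suppose $\mu$ is an ergodic IRS of the Basilica group $\mathfrak{B}$ such that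 $\mathrm{Fix}(H)$ is clopen (possibly empty) for $\mu$-a.e. $H$. Then $\mu$ is atomic, i.e. there is a countable set $S\subseteq\mathrm{Sub}(\mathfrak{B})$ with $\mu(\mathrm{Sub}(\mathfrak{B})\setminus S)=0$. -/

import Mathlib

open MeasureTheory
open scoped Pointwise

/-- The space `Sub(G)` of subgroups of a discrete group `G` carries the Chabauty topology: the
topology induced from the product topology on `{0,1}^G` (with `{0,1} = Bool` discrete) by sending
a subgroup to its indicator function. -/
noncomputable instance Subgroup.chabautyTopology {G : Type*} [Group G] : TopologicalSpace (Subgroup G) :=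
  TopologicalSpace.induced
    (fun (H : Subgroup G) (g : G) => @decide (g ∈ H) (Classical.propDecidable _))
    (inferInstance : TopologicalSpace (G → Bool))

/-- The Borel `σ`-algebra of the Chabauty topology. -/
noncomputable instance Subgroup.chabautyMeasurableSpace {G : Type*} [Group G] : MeasurableSpace (Subgroup G) :=
  borel (Subgroup G)

instance Subgroup.chabautyBorelSpace {G : Type*} [Group G] : BorelSpace (Subgroup G) := ⟨rfl⟩

/-- An *invariant random subgroup* of a discrete group `G`: a Borel probability measure on `Sub(G)`
which is invariant under conjugation by `G`. -/
structure IsIRS {G : Type*} [Group G] (μ : Measure (Subgroup G)) : Prop where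
  isProbabilityMeasure : IsProbabilityMeasure μ
  smulInvariantMeasure : SMulInvariantMeasure (ConjAct G) (Subgroup G) μ

/-- An invariant random subgroup which is ergodic for the conjugation action of `G`. -/
structure IsErgodicIRS {G : Type*} [Group G] (μ : Measure (Subgroup G)) : Prop
    extends IsIRS μ where
  ergodicSMul : ErgodicSMul (ConjAct G) (Subgroup G) μ

/-- A measure is (purely) atomic if it is carried by a countable set of points. -/
def IsAtomicMeasure {α : Type*} [MeasurableSpace α] (μ : Measure α) : Prop :=
  ∃ S : Set α, S.Countable ∧ μ Sᶜ = 0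

namespace BinaryTree

/-- The vertices of the rooted binary tree are the finite words over `{0,1}`
(`0 = false`, `1 = true`); the root is `[]`, the level of a vertex is its length, and the
descendants of `u` are the words having `u` as a prefix. -/
abbrev Vertex := List Bool

/-- The group of automorphisms of the rooted binary tree: the permutations of the vertices which
preserve the levels and the descendant relation. -/
def Aut : Subgroup (Equiv.Perm Vertex) where
  carrier := {f | (∀ u, (f u).length = u.length) ∧ ∀ u v, u <+: v → f u <+: f v}
  one_mem' := ⟨fun _ => rfl, fun _ _ h => h⟩
  mul_mem' := fun {f g} hf hg =>
    ⟨fun u => (hf.1 (g u)).trans (hg.1 u), fun u v h => hf.2 _ _ (hg.2 u v h)⟩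
  inv_mem' := by
    intro f hf
    have hinv : ∀ u, f (f⁻¹ u) = u := fun u => f.apply_symm_apply u
    have hlen : ∀ u, (f⁻¹ u).length = u.length := by
      intro u
      have := hf.1 (f⁻¹ u)
      rw [hinv] at this
      exact this.symm
    refine ⟨hlen, fun u v h => ?_⟩
    have h1 : f ((f⁻¹ v).take u.length) <+: v := by
      have := hf.2 _ _ (List.take_prefix u.length (f⁻¹ v))
      rwa [hinv] at this
    have h2 : f ((f⁻¹ v).take u.length) = u := by
      have hl : (f ((f⁻¹ v).take u.length)).length = u.length := by
        rw [hf.1, List.length_take, hlen]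
        exact min_eq_left h.length_le
      exact (List.prefix_of_prefix_length_le h1 h hl.le).eq_of_length hl
    have h3 : f⁻¹ u = (f⁻¹ v).take u.length := by
      rw [Equiv.Perm.inv_eq_iff_eq, h2]
    rw [h3]
    exact List.take_prefix _ _

/-- The boundary `∂T` of the binary tree: the space of infinite rays from the root, i.e. of
infinite words over `{0,1}`, with the product topology (the cylinder sets form a base). -/
abbrev Boundary := ℕ → Bool

/-- The vertex of level `n` on a ray. -/
def prefixAt (x : Boundary) (n : ℕ) : Vertex := List.ofFn fun i : Fin n => x i

theorem length_prefixAt (x : Boundary) (n : ℕ) : (prefixAt x n).length = n := by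
  simp [prefixAt]

theorem getElem?_prefixAt (x : Boundary) {i n : ℕ} (h : i < n) :
    (prefixAt x n)[i]? = some (x i) := by
  simp [prefixAt, h]

theorem prefixAt_prefix (x : Boundary) {m n : ℕ} (h : m ≤ n) :
    prefixAt x m <+: prefixAt x n := by
  rw [List.prefix_iff_getElem?]
  intro i hi
  have hi' : i < m := by rwa [length_prefixAt] at hi
  rw [getElem?_prefixAt x (hi'.trans_le h)]
  simp [prefixAt]

theorem ext_prefixAt {x y : Boundary} (h : ∀ n, prefixAt x n = prefixAt y n) : x = y := by
  funext n
  have := congrArg (fun l : Vertex => l[n]?) (h (n + 1))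
  simp only [getElem?_prefixAt _ (Nat.lt_succ_self n)] at this
  exact Option.some.inj this

/-- The image of the ray `x` under the automorphism `g`: its `n`-th letter is the last letter of
the image under `g` of the vertex of level `n + 1` on `x`. -/
def rayMap (g : Aut) (x : Boundary) : Boundary :=
  fun n => ((g : Equiv.Perm Vertex) (prefixAt x (n + 1)))[n]?.getD false

/-- `rayMap g x` is the unique ray which passes through the images under `g` of the vertices
of `x`. -/
theorem prefixAt_rayMap (g : Aut) (x : Boundary) (n : ℕ) :
    prefixAt (rayMap g x) n = (g : Equiv.Perm Vertex) (prefixAt x n) := by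
  have hl : ∀ k, ((g : Equiv.Perm Vertex) (prefixAt x k)).length = k := fun k => by
    rw [g.2.1, length_prefixAt]
  refine List.ext_getElem? fun i => ?_
  by_cases hi : i < n
  · have hp := g.2.2 _ _ (prefixAt_prefix x (Nat.succ_le_of_lt hi))
    have hi2 : i < ((g : Equiv.Perm Vertex) (prefixAt x (i + 1))).length := by
      rw [hl]; exact Nat.lt_succ_self i
    have h3 := List.prefix_iff_getElem?.1 hp i hi2
    rw [getElem?_prefixAt _ hi, h3, rayMap, List.getElem?_eq_getElem hi2, Option.getD_some]
  · rw [List.getElem?_eq_none (by rw [length_prefixAt]; omega),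
      List.getElem?_eq_none (by rw [hl]; omega)]

/-- The action of the automorphism group on the boundary. -/
instance : MulAction Aut Boundary where
  smul := rayMap
  one_smul x := ext_prefixAt fun n => prefixAt_rayMap 1 x n
  mul_smul g h x := ext_prefixAt fun n => by
    change prefixAt (rayMap (g * h) x) n = prefixAt (rayMap g (rayMap h x)) n
    rw [prefixAt_rayMap, prefixAt_rayMap, prefixAt_rayMap]
    rfl

/-- The set of points of the boundary fixed by all elements of a subgroup `H` of a group `Γ` of
automorphisms of the tree. -/
def boundaryFix {Γ : Subgroup Aut} (H : Subgroup Γ) : Set Boundary :=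
  {x | ∀ h ∈ H, h • x = x}

mutual

/-- `a = (1, b)`: `a` fixes the first letter, acts trivially below `0`, and as `b` below `1`. -/
def aFun : Vertex → Vertex
  | [] => []
  | false :: w => false :: w
  | true :: w => true :: bFun w

/-- `b = (1, a)ε`: `b` flips the first letter, after acting trivially below `0`, and as `a`
below `1`. -/
def bFun : Vertex → Vertex
  | [] => []
  | false :: w => true :: w
  | true :: w => false :: aFun w

end

mutual

/-- The inverse of `a`. -/
def aInvFun : Vertex → Vertex
  | [] => []
  | false :: w => false :: w
  | true :: w => true :: bInvFun w

/-- The inverse of `b`. -/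
def bInvFun : Vertex → Vertex
  | [] => []
  | true :: w => false :: w
  | false :: w => true :: aInvFun w

end

theorem leftInv : ∀ w, aInvFun (aFun w) = w ∧ bInvFun (bFun w) = w := by
  intro w
  induction w with
  | nil => simp [aFun, bFun, aInvFun, bInvFun]
  | cons c w ih => cases c <;> simp [aFun, bFun, aInvFun, bInvFun, ih.1, ih.2]

theorem rightInv : ∀ w, aFun (aInvFun w) = w ∧ bFun (bInvFun w) = w := by
  intro w
  induction w with
  | nil => simp [aFun, bFun, aInvFun, bInvFun]
  | cons c w ih => cases c <;> simp [aFun, bFun, aInvFun, bInvFun, ih.1, ih.2]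

theorem lengthFun : ∀ w, (aFun w).length = w.length ∧ (bFun w).length = w.length := by
  intro w
  induction w with
  | nil => simp [aFun, bFun]
  | cons c w ih => cases c <;> simp [aFun, bFun, ih.1, ih.2]

theorem prefixFun : ∀ u v : Vertex, u <+: v → aFun u <+: aFun v ∧ bFun u <+: bFun v := by
  intro u
  induction u with
  | nil => intro v _; simp [aFun, bFun]
  | cons c u ih =>
    intro v h
    cases v with
    | nil => simp at h
    | cons d v =>
      rw [List.cons_prefix_cons] at h
      obtain ⟨rfl, h⟩ := h
      cases c <;> simp [aFun, bFun, h, ih v h]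

/-- The generator `a = (1, b)` of the Basilica group. -/
def a : Aut :=
  ⟨⟨aFun, aInvFun, fun w => (leftInv w).1, fun w => (rightInv w).1⟩,
    fun w => (lengthFun w).1, fun u v h => (prefixFun u v h).1⟩

/-- The generator `b = (1, a)ε` of the Basilica group. -/
def b : Aut :=
  ⟨⟨bFun, bInvFun, fun w => (leftInv w).2, fun w => (rightInv w).2⟩,
    fun w => (lengthFun w).2, fun u v h => (prefixFun u v h).2⟩

/-- The Basilica group, the group of automorphisms of the rooted binary tree generated by
`a = (1, b)` and `b = (1, a)ε`. -/
def Basilica : Subgroup Aut := Subgroup.closure {a, b}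

end BinaryTree

-- Borel–Cantelli for invariant random subgroups

namespace Subgroup

variable {G K : Type*} [Group G] [Group K]

-- Almost every `H` lies in a countable set that does not depend on `μ`, namely the union of the
-- `almostProduct n`. Suppose `γ ∈ H` moves a vertex `w`. Invariance of `μ` and Borel–Cantelli
-- (`ae_finiteIndex_pairedProjection`) show that, almost surely, the part of `H` acting below `w`
-- and `γ w` projects onto a finite index subgroup of the copy of `D1` below `w`. Taking commutators
-- twice to cancel unwanted factors, `HasLargeProjections.exists_map_emb_D2_le` finds a whole copy
-- of `D2` in `H` below some vertex of every ray that `H` moves. When the fixed set is open, every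
-- fixed ray has a vertex below which `H` is trivial, and compactness of the boundary gives one
-- level `n` serving all rays. Such an `H` is determined by its fixed vertices of level `n` and by
-- its product with `levelD2 n`. Only countably many products occur, because the quotient of the
-- Basilica group by `levelD2 n` is Noetherian (`relNoetherian_levelD2`).

theorem continuous_decide_mem (g : G) :
    Continuous fun H : Subgroup G => @decide (g ∈ H) (Classical.propDecidable _) :=
  (continuous_apply g).comp (continuous_induced_dom
    (f := fun (H : Subgroup G) (g : G) => @decide (g ∈ H) (Classical.propDecidable _)))

theorem measurableSet_mem (g : G) : MeasurableSet {H : Subgroup G | g ∈ H} := by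
  convert ((isClosed_discrete {true}).preimage (continuous_decide_mem g)).measurableSet using 1
  ext H
  simp

/-- The first projection of `H ∩ (e(K) × f(K))`, where `e` and `f` have commuting images. -/
def pairedProjection (e f : K →* G) (hef : ∀ p q, Commute (e p) (f q)) (H : Subgroup G) :
    Subgroup K :=
  (H.comap (e.noncommCoprod f hef)).map (MonoidHom.fst K K)

theorem mem_pairedProjection {e f : K →* G} {hef : ∀ p q, Commute (e p) (f q)} {H : Subgroup G}
    {p : K} : p ∈ pairedProjection e f hef H ↔ ∃ q, e p * f q ∈ H := by
  simp [pairedProjection]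

theorem smul_mem_iff {g : G} {H : Subgroup G} {r : G} :
    g ∈ ConjAct.toConjAct r • H ↔ r⁻¹ * g * r ∈ H := by
  rw [mem_pointwise_smul_iff_inv_smul_mem, ← ConjAct.toConjAct_inv, ConjAct.toConjAct_smul, inv_inv]

theorem measurable_conj_smul (g : ConjAct G) : Measurable fun H : Subgroup G => g • H := by
  have hc : Continuous fun H : Subgroup G => g • H := by
    refine continuous_induced_rng.2 (continuous_pi fun x => ?_)
    exact (continuous_congr fun H => (@decide_eq_decide _ _ (_) (_)).2
      mem_pointwise_smul_iff_inv_smul_mem).2 (continuous_decide_mem (g⁻¹ • x))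
  exact hc.measurable

/-- A subgroup has finite index if only finitely many elements are the first, in an enumeration, of
their left coset. -/
theorem finiteIndex_of_finite_setOf_first (i : K → ℕ) (P : Subgroup K)
    (h : {r : K | ∀ s, i s < i r → s⁻¹ * r ∉ P}.Finite) : P.FiniteIndex := by
  have : Finite (K ⧸ P) := by
    have := h.to_subtype
    refine Finite.of_surjective
      (fun r : {r : K | ∀ s, i s < i r → s⁻¹ * r ∉ P} => (r.1 : K ⧸ P)) ?_
    intro x
    induction x using QuotientGroup.induction_on with
    | H x =>
    obtain ⟨r, hr, hmin⟩ := (measure i).wf.has_min {r : K | (r : K ⧸ P) = x} ⟨x, rfl⟩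
    refine ⟨⟨r, fun s hs hsr => hmin s ?_ hs⟩, hr⟩
    exact (QuotientGroup.eq.2 hsr).trans hr
  exact finiteIndex_of_finite_quotient

/-- If an invariant random subgroup `H` contains `γ`, and `γ` conjugates `e(K)` into its
centralizer, then the projection of `H ∩ (e(K) × γe(K)γ⁻¹)` to `K` has finite index. -/
theorem ae_finiteIndex_pairedProjection [Countable K] {μ : Measure (Subgroup G)} (hμ : IsIRS μ)
    (e : K →* G) (γ : G)
    (h : ∀ p q, Commute (e p) (((MulAut.conj γ).toMonoidHom.comp e) q)) :
    ∀ᵐ H ∂μ, γ ∈ H → (pairedProjection e _ h H).FiniteIndex := by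
  have := hμ.isProbabilityMeasure
  have := hμ.smulInvariantMeasure
  obtain ⟨i, hi⟩ := exists_injective_nat K
  set P := pairedProjection e _ h with hP
  have hPm : ∀ p, MeasurableSet {H | p ∈ P H} := fun p => by
    simp only [hP, mem_pairedProjection, Set.ofPred_exists]
    exact MeasurableSet.iUnion fun q => measurableSet_mem _
  -- Conjugation by `e r` carries `E r` to `F r` without changing its measure. The sets `F r` are
  -- disjoint, although the `E r` need not be.
  let E : K → Set (Subgroup G) := fun r => {H | γ ∈ H ∧ ∀ s, i s < i r → s⁻¹ * r ∉ P H}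
  have hE : ∀ r, MeasurableSet (E r) := fun r => by
    refine (measurableSet_mem γ).inter ?_
    have : {H | ∀ s, i s < i r → s⁻¹ * r ∉ P H} = ⋂ s, ⋂ (_ : i s < i r), {H | s⁻¹ * r ∈ P H}ᶜ := by
      ext H
      simp
    change MeasurableSet {H | ∀ s, i s < i r → s⁻¹ * r ∉ P H}
    rw [this]
    exact MeasurableSet.iInter fun s => MeasurableSet.iInter fun _ => (hPm _).compl
  let F : K → Set (Subgroup G) := fun r =>
    (fun H => (ConjAct.toConjAct (e r))⁻¹ • H) ⁻¹' E r
  have hF : ∀ r, MeasurableSet (F r) := fun r => measurable_conj_smul _ (hE r)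
  have hμF : ∀ r, μ (F r) = μ (E r) := fun r => measure_preimage_smul μ _ _
  -- Here `H` contains the conjugates of `γ` by `e r` and by `e s`. Their quotient, conjugated by
  -- `(e r)⁻¹`, is `e (r⁻¹ s) * γ e (s⁻¹ r) γ⁻¹`, so `r` is not first in its coset of the projection
  -- of `(e r)⁻¹ • H`.
  have key : ∀ r s, i s < i r → Disjoint (F r) (F s) := by
    intro r s hsr
    rw [Set.disjoint_left]
    rintro H ⟨hr, hr'⟩ ⟨hs, -⟩
    refine hr' s hsr ?_
    rw [← ConjAct.toConjAct_inv, ← map_inv, smul_mem_iff] at hr hs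
    rw [← inv_mem_iff, hP, mem_pairedProjection]
    refine ⟨((s⁻¹ * r)⁻¹)⁻¹, ?_⟩
    rw [← ConjAct.toConjAct_inv, ← map_inv, smul_mem_iff]
    convert H.mul_mem hs (H.inv_mem hr) using 1
    simp only [MonoidHom.coe_comp, Function.comp_apply, MulEquiv.toMonoidHom_eq_coe,
      MonoidHom.coe_coe, MulAut.conj_apply, map_mul, map_inv, mul_inv_rev, inv_inv]
    group
  have hdisj : Pairwise (Function.onFun Disjoint F) := by
    intro r s hrs
    rcases lt_or_gt_of_ne (hi.ne hrs) with h1 | h1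
    · exact (key s r h1).symm
    · exact key r s h1
  -- Disjointness bounds the sum by the total mass. By Borel–Cantelli, almost every `H` lies in
  -- finitely many `E r`, so there are finitely many cosets.
  have hsum : ∑' r, μ (E r) ≠ ⊤ := by
    simp only [← hμF]
    refine ne_top_of_le_ne_top (measure_ne_top μ Set.univ)
      (tsum_measure_le_measure_univ (fun r => (hF r).nullMeasurableSet) fun r s hrs =>
        (hdisj hrs).aedisjoint)
  filter_upwards [ae_finite_setOfPred_mem hsum] with H hH hγ
  refine finiteIndex_of_finite_setOf_first i _ (hH.subset fun r hr => ⟨hγ, hr⟩)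

end Subgroup

-- Relative Noetherianity

namespace Subgroup

variable {G G' : Type*} [Group G] [Group G']

/-- Every subgroup between `B` and `A` is finitely generated relative to `B`. -/
def RelNoetherian (A B : Subgroup G) : Prop :=
  ∀ H : Subgroup G, B ≤ H → H ≤ A → ∃ S : Set G, S.Finite ∧ H = closure S ⊔ B

theorem mem_sup_of_le_normalizer {H N : Subgroup G} (h : H ≤ normalizer (N : Set G)) {x : G} :
    x ∈ H ⊔ N ↔ ∃ y ∈ H, ∃ z ∈ N, y * z = x := by
  rw [← SetLike.mem_coe, coe_mul_of_left_le_normalizer_right H N h, Set.mem_mul]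
  rfl

namespace RelNoetherian

variable {A A' B B' C N : Subgroup G}

theorem mono (h : RelNoetherian A B) (hA : A' ≤ A) (hB : B ≤ B') : RelNoetherian A' B' := by
  intro H h1 h2
  obtain ⟨S, hS, e⟩ := h H (hB.trans h1) (h2.trans hA)
  refine ⟨S, hS, le_antisymm ?_ (sup_le ?_ h1)⟩
  · exact e.le.trans (sup_le_sup_left hB _)
  · exact le_sup_left.trans e.ge

theorem map (h : RelNoetherian A B) (hBA : B ≤ A) (f : G →* G') :
    RelNoetherian (A.map f) (B.map f) := by
  intro H h1 h2
  obtain ⟨S, hS, e⟩ := h (H.comap f ⊓ A) (le_inf (map_le_iff_le_comap.1 h1) hBA) inf_le_right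
  refine ⟨f '' S, hS.image f, ?_⟩
  rw [← MonoidHom.map_closure, ← map_sup, ← e]
  refine le_antisymm (fun x hx => ?_) (map_le_iff_le_comap.2 inf_le_left)
  obtain ⟨y, hy, rfl⟩ := h2 hx
  exact ⟨y, ⟨hx, hy⟩, rfl⟩

/-- Generators of `H ⊔ N` over `N` can be corrected by elements of `N` to lie in `H`. Together with
generators of `H ⊓ N` over `B` they generate `H` over `B`. -/
theorem trans (h : RelNoetherian A N) (h' : RelNoetherian N B) (hNA : N ≤ A) (hBN : B ≤ N)
    (hn : A ≤ normalizer (N : Set G)) : RelNoetherian A B := by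
  intro H h1 h2
  obtain ⟨T, hT, eT⟩ := h (H ⊔ N) le_sup_right (sup_le h2 hNA)
  obtain ⟨S, hS, eS⟩ := h' (H ⊓ N) (le_inf h1 hBN) inf_le_right
  have hx : ∀ t : T, ∃ y ∈ H, ∃ z ∈ N, y * z = t := fun t => by
    rw [← mem_sup_of_le_normalizer (h2.trans hn), eT]
    exact le_sup_left (a := closure T) (subset_closure t.2)
  choose f hf g hg hfg using hx
  have := hT.to_subtype
  have hcl : closure (Set.range f) ≤ H := by
    rw [closure_le]
    rintro _ ⟨t, rfl⟩
    exact hf t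
  refine ⟨Set.range f ∪ S, (Set.finite_range f).union hS, le_antisymm ?_ ?_⟩
  · have h3 : H ≤ closure (Set.range f) ⊔ N := by
      refine le_sup_left.trans (eT.le.trans (sup_le ?_ le_sup_right))
      rw [closure_le]
      intro t ht
      obtain ⟨t, rfl⟩ : ∃ t' : T, t' = t := ⟨⟨t, ht⟩, rfl⟩
      rw [← hfg t]
      exact mul_mem_sup (subset_closure ⟨_, rfl⟩) (hg _)
    intro x hx
    obtain ⟨y, hy, z, hz, rfl⟩ :=
      (mem_sup_of_le_normalizer ((hcl.trans h2).trans hn)).1 (h3 hx)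
    have hz' : z ∈ H ⊓ N := ⟨(H.mul_mem_cancel_left (hcl hy)).1 hx, hz⟩
    rw [eS] at hz'
    rw [closure_union, sup_assoc]
    exact mul_mem_sup hy hz'
  · rw [closure_union, sup_assoc, ← eS]
    exact sup_le hcl inf_le_left

theorem sup (h : RelNoetherian A B) (hn : A ≤ normalizer (C : Set G)) (hBA : B ≤ A):
    RelNoetherian (A ⊔ C) (B ⊔ C) := by
  intro H h1 h2
  obtain ⟨S, hS, e⟩ := h (H ⊓ A) (le_inf (le_sup_left.trans h1) hBA) inf_le_right
  refine ⟨S, hS, ?_⟩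
  rw [← sup_assoc, ← e]
  refine le_antisymm (fun x hx => ?_) (sup_le inf_le_left (le_sup_right.trans h1))
  obtain ⟨y, hy, z, hz, rfl⟩ := (mem_sup_of_le_normalizer hn).1 (h2 hx)
  exact mul_mem_sup ⟨(H.mul_mem_cancel_right ((le_sup_right.trans h1) hz)).1 hx, hy⟩ hz

theorem zpowers_sup {x : G} (h : x ∈ normalizer (C : Set G)) :
    RelNoetherian (zpowers x ⊔ C) C := by
  have : RelNoetherian (zpowers x) ⊥ := by
    intro H _ h2
    obtain ⟨y, hy⟩ := (Subgroup.isCyclic_iff_exists_zpowers_eq_top H).1 (isCyclic_of_le h2)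
    exact ⟨{y}, Set.finite_singleton y, by rw [← zpowers_eq_closure, hy, sup_bot_eq]⟩
  simpa using this.sup (C := C) (by simpa [zpowers_le] using h) bot_le

theorem countable_setOf (h : RelNoetherian A B) (hA : (A : Set G).Countable) :
    {H : Subgroup G | B ≤ H ∧ H ≤ A}.Countable := by
  refine ((Set.countable_ofPred_finite_subset hA).image fun S => closure S ⊔ B).mono ?_
  rintro H ⟨h1, h2⟩
  obtain ⟨S, hS, e⟩ := h H h1 h2
  exact ⟨S, ⟨hS, fun x hx => h2 (e.ge (le_sup_left (a := closure S) (subset_closure hx)))⟩, e.symm⟩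

end RelNoetherian

end Subgroup

open scoped commutatorElement

/-- Applied to factors supported below different vertices: only `p` and `r` may share a support, so
the other two cancel. -/
theorem commutator_mul_mul_of_commute {G : Type*} [Group G] {p q r s : G} (h1 : Commute q r)
    (h2 : Commute q s) (h3 : Commute s p) : ⁅p * q, r * s⁆ = ⁅p, r⁆ := by
  have e1 : q * (r * s) * q⁻¹ = r * s := by
    rw [(h1.mul_right h2).eq, mul_inv_cancel_right]
  have e2 : s * p⁻¹ * s⁻¹ = p⁻¹ := by
    rw [h3.inv_right.eq, mul_inv_cancel_right]
  calc ⁅p * q, r * s⁆ = p * (q * (r * s) * q⁻¹) * p⁻¹ * (r * s)⁻¹ := by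
        rw [commutatorElement_def]; group
    _ = p * r * (s * p⁻¹ * s⁻¹) * r⁻¹ := by rw [e1]; group
    _ = ⁅p, r⁆ := by rw [e2, commutatorElement_def]

-- Tree automorphisms, generators and derived subgroups

namespace BinaryTree

instance : CoeFun Aut fun _ => Vertex → Vertex := ⟨fun g => (g : Equiv.Perm Vertex)⟩

theorem Aut.ext {g h : Aut} (H : ∀ u, g u = h u) : g = h := Subtype.ext (Equiv.ext H)

@[simp] theorem mul_apply (g h : Aut) (u : Vertex) : (g * h) u = g (h u) := rfl

@[simp] theorem inv_apply_self (g : Aut) (u : Vertex) : g⁻¹ (g u) = u :=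
  (g : Equiv.Perm Vertex).symm_apply_apply u

@[simp] theorem apply_inv_self (g : Aut) (u : Vertex) : g (g⁻¹ u) = u :=
  (g : Equiv.Perm Vertex).apply_symm_apply u

@[simp] theorem length_apply (g : Aut) (u : Vertex) : (g u).length = u.length := g.2.1 u

theorem prefix_apply (g : Aut) {u v : Vertex} (h : u <+: v) : g u <+: g v := g.2.2 u v h

theorem apply_injective (g : Aut) : Function.Injective g := (g : Equiv.Perm Vertex).injective

theorem eq_of_prefix_of_prefix {u v w : Vertex} (hu : u <+: w) (hv : v <+: w)
    (h : u.length = v.length) : u = v :=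
  (List.prefix_of_prefix_length_le hu hv h.le).eq_of_length h

theorem prefix_of_apply {g : Aut} {u v : Vertex} (h : g u <+: g v) : u <+: v := by
  simpa using prefix_apply g⁻¹ h

/-- The action of `g` on the vertices below the vertex `c` of the first level. -/
def inclFun (c : Bool) (g : Vertex → Vertex) : Vertex → Vertex
  | [] => []
  | d :: u => if d = c then d :: g u else d :: u

theorem inclFun_comp (c : Bool) (g h : Vertex → Vertex) (u : Vertex) :
    inclFun c g (inclFun c h u) = inclFun c (fun u => g (h u)) u := by
  cases u with
  | nil => rfl
  | cons d u => by_cases h : d = c <;> simp [inclFun, h]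

theorem inclFun_id (c : Bool) (u : Vertex) : inclFun c (fun u => u) u = u := by
  cases u with
  | nil => rfl
  | cons d u => simp [inclFun]

/-- The automorphism acting as `g` below the vertex `c` of the first level, and trivially
elsewhere. -/
def incl (c : Bool) : Aut →* Aut where
  toFun g := ⟨⟨inclFun c g, inclFun c (g⁻¹ : Aut),
      fun u => by simp [inclFun_comp, inclFun_id], fun u => by simp [inclFun_comp, inclFun_id]⟩, by
    constructor
    · rintro (_ | ⟨d, u⟩)
      · rfl
      · by_cases h : d = c <;> simp [inclFun, h]
    · rintro (_ | ⟨d, u⟩) v huv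
      · exact List.nil_prefix
      · obtain ⟨v, rfl⟩ := huv
        by_cases h : d = c
        · simp [inclFun, h, prefix_apply g (List.prefix_append u v)]
        · simp [inclFun, h]⟩
  map_one' := Aut.ext fun u => inclFun_id c u
  map_mul' g h := Aut.ext fun u => (inclFun_comp c g h u).symm

theorem incl_cons (c : Bool) (g : Aut) (d : Bool) (u : Vertex) :
    incl c g (d :: u) = if d = c then d :: g u else d :: u := rfl

@[simp] theorem incl_cons_self (c : Bool) (g : Aut) (u : Vertex) :
    incl c g (c :: u) = c :: g u := by simp [incl_cons]

theorem incl_cons_of_ne {c d : Bool} (h : d ≠ c) (g : Aut) (u : Vertex) :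
    incl c g (d :: u) = d :: u := by simp [incl_cons, h]

theorem commute_incl {c d : Bool} (h : c ≠ d) (g k : Aut) : Commute (incl c g) (incl d k) := by
  refine Aut.ext fun u => ?_
  cases u with
  | nil => rfl
  | cons e u =>
    simp only [mul_apply, incl_cons]
    split_ifs <;> simp_all [incl_cons]

/-- The automorphism acting as `g` below the vertex `w`, and trivially elsewhere. -/
def emb : Vertex → Aut →* Aut
  | [] => MonoidHom.id Aut
  | c :: w => (incl c).comp (emb w)

theorem emb_cons (c : Bool) (w : Vertex) (g : Aut) : emb (c :: w) g = incl c (emb w g) := rfl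

theorem emb_append (v w : Vertex) (g : Aut) : emb (v ++ w) g = emb v (emb w g) := by
  induction v with
  | nil => rfl
  | cons c v ih => rw [List.cons_append, emb_cons, ih, emb_cons]

@[simp] theorem emb_apply_append (w u : Vertex) (g : Aut) : emb w g (w ++ u) = w ++ g u := by
  induction w with
  | nil => rfl
  | cons c w ih => rw [List.cons_append, emb_cons, incl_cons_self, ih, List.cons_append]

/-- The automorphisms which fix all vertices that are not descendants of `w`. -/
def supportedBelow (w : Vertex) : Subgroup Aut where
  carrier := {g | ∀ u, ¬ w <+: u → g u = u}
  one_mem' _ _ := rfl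
  mul_mem' {g h} hg hh u hu := by rw [mul_apply, hh u hu, hg u hu]
  inv_mem' {g} hg u hu := by
    conv_lhs => rw [← hg u hu]
    simp

theorem emb_mem_supportedBelow (w : Vertex) (g : Aut) : emb w g ∈ supportedBelow w := by
  induction w with
  | nil => exact fun u hu => absurd List.nil_prefix hu
  | cons c w ih =>
    rintro (_ | ⟨d, u⟩) hu
    · rfl
    · by_cases h : d = c
      · subst h
        rw [emb_cons, incl_cons_self, ih u (fun h => hu (by simpa using h))]
      · rw [emb_cons, incl_cons_of_ne h]

theorem conj_mem_supportedBelow {w : Vertex} {g : Aut} (hg : g ∈ supportedBelow w) (k : Aut) :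
    k * g * k⁻¹ ∈ supportedBelow (k w) := by
  intro u hu
  rw [mul_apply, mul_apply, hg _ (fun h => hu (by simpa using prefix_apply k h)), apply_inv_self]

theorem apply_of_length_le {w : Vertex} {g : Aut} (hg : g ∈ supportedBelow w) {u : Vertex}
    (hu : u.length ≤ w.length) : g u = u := by
  by_cases h : u = w
  · subst h
    by_contra hne
    have : g (g u) = g u := hg _ fun h => hne (h.eq_of_length (by simp)).symm
    exact hne (apply_injective g this)
  · exact hg u fun h' => h (h'.eq_of_length (le_antisymm h'.length_le hu)).symm

theorem prefix_apply_iff {w : Vertex} {g : Aut} (hg : g w = w) {u : Vertex} :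
    w <+: g u ↔ w <+: u := by
  conv_lhs => rw [← hg]
  exact ⟨prefix_of_apply, prefix_apply g⟩

theorem commute_of_supportedBelow {v w : Vertex} (hl : v.length = w.length) (hvw : v ≠ w)
    {g h : Aut} (hg : g ∈ supportedBelow v) (hh : h ∈ supportedBelow w) : Commute g h := by
  have key : ∀ {v w : Vertex}, v.length = w.length → v ≠ w → ∀ {g h : Aut},
      g ∈ supportedBelow v → h ∈ supportedBelow w → ∀ u, v <+: u → g (h u) = h (g u) := by
    intro v w hl hvw g h hg hh u hu
    have h1 : ∀ {x}, v <+: x → h x = x := fun hx =>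
      hh _ fun h2 => hvw (eq_of_prefix_of_prefix hx h2 hl)
    rw [h1 hu, h1 ((prefix_apply_iff (apply_of_length_le hg le_rfl)).2 hu)]
  refine Aut.ext fun u => ?_
  rw [mul_apply, mul_apply]
  by_cases h1 : v <+: u
  · exact key hl hvw hg hh u h1
  by_cases h2 : w <+: u
  · exact (key hl.symm hvw.symm hh hg u h2).symm
  · rw [hh u h2, hg u h1, hh u h2]

/-! ### The generators -/

theorem a_eq : a = incl true b := by
  refine Aut.ext fun u => ?_
  rcases u with _ | ⟨_ | _, u⟩ <;> rfl

theorem b_conj_incl_false (g : Aut) : b * incl false g * b⁻¹ = incl true g := by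
  rw [mul_inv_eq_iff_eq_mul]
  refine Aut.ext fun u => ?_
  rcases u with _ | ⟨_ | _, u⟩ <;> rfl

theorem b_conj_incl_true (g : Aut) : b * incl true g * b⁻¹ = incl false (a * g * a⁻¹) := by
  rw [mul_inv_eq_iff_eq_mul]
  refine Aut.ext fun u => ?_
  rcases u with _ | ⟨_ | _, u⟩
  · rfl
  · rfl
  · change false :: a (g u) = false :: a (g (a⁻¹ (a u)))
    rw [inv_apply_self]

theorem b_sq : b * b = incl false a * incl true a := by
  refine Aut.ext fun u => ?_
  rcases u with _ | ⟨_ | _, u⟩ <;> rfl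

theorem a_mem : a ∈ Basilica := Subgroup.subset_closure (by simp)

theorem b_mem : b ∈ Basilica := Subgroup.subset_closure (by simp)

theorem Basilica_le {H : Subgroup Aut} (ha : a ∈ H) (hb : b ∈ H) : Basilica ≤ H := by
  rw [Basilica, Subgroup.closure_le]
  rintro x (rfl | rfl) <;> assumption

/-- The element `a⁻¹b⁻¹ab = (b, b⁻¹)` of the Basilica group. -/
def c : Aut := incl false b * incl true b⁻¹

theorem c_eq : c = ⁅a⁻¹, b⁻¹⁆ := by
  have h : b * incl false b = incl true b * b := by
    rw [← b_conj_incl_false, inv_mul_cancel_right]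
  rw [commutatorElement_def, inv_inv, inv_inv, c, (commute_incl (by simp) b b⁻¹).eq, map_inv, a_eq,
    mul_assoc, mul_assoc, mul_right_inj, eq_inv_mul_iff_mul_eq, h]

theorem a_commute_c : Commute a c := by
  rw [a_eq, c]
  refine (commute_incl (by simp) _ _).mul_right ?_
  rw [map_inv]
  exact (Commute.refl _).inv_right

/-- The derived subgroup of the Basilica group. -/
def D1 : Subgroup Aut := ⁅Basilica, Basilica⁆

/-- The second derived subgroup of the Basilica group. -/
def D2 : Subgroup Aut := ⁅D1, D1⁆

theorem D1_le : D1 ≤ Basilica := Subgroup.commutator_le_self Basilica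

theorem D2_le : D2 ≤ D1 := Subgroup.commutator_le_self D1

theorem c_mem : c ∈ D1 :=
  c_eq ▸ Subgroup.commutator_mem_commutator (inv_mem a_mem) (inv_mem b_mem)

theorem conj_mem_D1 {g h : Aut} (hg : g ∈ Basilica) (hh : h ∈ D1) : g * h * g⁻¹ ∈ D1 := by
  have := mul_mem (Subgroup.commutator_mem_commutator hg (D1_le hh)) hh
  rwa [commutatorElement_def, inv_mul_cancel_right] at this

theorem conj_mem_D2 {g h : Aut} (hg : g ∈ Basilica) (hh : h ∈ D2) : g * h * g⁻¹ ∈ D2 := by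
  have : D2.map (MulAut.conj g).toMonoidHom ≤ D2 := by
    rw [D2, Subgroup.map_commutator]
    have : D1.map (MulAut.conj g).toMonoidHom ≤ D1 := by
      rintro _ ⟨x, hx, rfl⟩
      exact conj_mem_D1 hg hx
    exact Subgroup.commutator_mono this this
  exact this ⟨h, hh, rfl⟩

theorem Basilica_le_normalizer {L : Subgroup Aut}
    (h : ∀ g ∈ Basilica, ∀ x ∈ L, g * x * g⁻¹ ∈ L) :
    Basilica ≤ Subgroup.normalizer (L : Set Aut) := by
  intro g hg
  rw [Subgroup.mem_normalizer_iff]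
  refine fun x => ⟨h g hg x, fun hx => ?_⟩
  simpa [mul_assoc] using h g⁻¹ (inv_mem hg) _ hx

/-- The stabilizer of the first level in the Basilica group maps onto it in each coordinate. -/
theorem exists_incl_mul_incl_mem {g : Aut} (hg : g ∈ Basilica) :
    ∃ h, incl false h * incl true g ∈ Basilica := by
  let S : Subgroup Aut := (Basilica.comap ((incl false).noncommCoprod (incl true)
    (commute_incl (by simp)))).map (MonoidHom.snd Aut Aut)
  have hS : ∀ {x}, x ∈ S ↔ ∃ h, incl false h * incl true x ∈ Basilica := by simp [S]
  refine hS.1 (Basilica_le (hS.2 ⟨a, ?_⟩) (hS.2 ⟨1, ?_⟩) hg)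
  · exact b_sq ▸ mul_mem b_mem b_mem
  · rw [map_one, one_mul, ← a_eq]
    exact a_mem

/-- Some `(h, g)` lies in the Basilica group, and its first coordinate does not affect an element
acting only below `1`. -/
theorem incl_true_conj_mem {L : Subgroup Aut} (hL : ∀ g ∈ Basilica, ∀ x ∈ L, g * x * g⁻¹ ∈ L)
    {g x : Aut} (hg : g ∈ Basilica) (hx : incl true x ∈ L) : incl true (g * x * g⁻¹) ∈ L := by
  obtain ⟨h, hh⟩ := exists_incl_mul_incl_mem hg
  convert hL _ hh _ hx using 1
  have h1 := (commute_incl (c := false) (d := true) (by simp) h (g * x * g⁻¹)).eq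
  simp only [map_mul, map_inv] at h1 ⊢
  rw [mul_inv_rev, ← mul_assoc, eq_mul_inv_iff_mul_eq, ← h1]
  group

theorem incl_false_mem_iff {L : Subgroup Aut} (hL : ∀ g ∈ Basilica, ∀ x ∈ L, g * x * g⁻¹ ∈ L)
    {x : Aut} : incl false x ∈ L ↔ incl true x ∈ L := by
  rw [← b_conj_incl_false]
  exact (Subgroup.mem_normalizer_iff.1 (Basilica_le_normalizer hL b_mem) _)

theorem commutator_mem_of_generators {L : Subgroup Aut}
    (hL : ∀ g ∈ Basilica, ∀ x ∈ L, g * x * g⁻¹ ∈ L) {x : Aut} (ha : ⁅x, a⁆ ∈ L) (hb : ⁅x, b⁆ ∈ L)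
    {g : Aut} (hg : g ∈ Basilica) : ⁅x, g⁆ ∈ L := by
  refine Subgroup.closure_induction (p := fun g _ => ⁅x, g⁆ ∈ L) ?_ ?_ ?_ ?_ hg
  · rintro y (rfl | rfl) <;> assumption
  · simp
  · intro y z hy _ h1 h2
    convert mul_mem h1 (hL y hy _ h2) using 1
    simp only [commutatorElement_def]
    group
  · intro y hy h1
    convert hL _ (inv_mem hy) _ (inv_mem h1) using 1
    simp only [commutatorElement_def]
    group

/-- A subgroup normalized by the Basilica group contains `D1` if it contains `⁅a, b⁆`. -/
theorem D1_le_of_commutator_mem {L : Subgroup Aut}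
    (hL : ∀ g ∈ Basilica, ∀ x ∈ L, g * x * g⁻¹ ∈ L) (h : ⁅a, b⁆ ∈ L) : D1 ≤ L := by
  have hinv : ∀ {x y : Aut}, ⁅x, y⁆ ∈ L → ⁅y, x⁆ ∈ L := fun {x y} hxy =>
    commutatorElement_inv x y ▸ inv_mem hxy
  refine Subgroup.commutator_le.2 fun g hg k hk => commutator_mem_of_generators hL ?_ ?_ hk
  · exact hinv (commutator_mem_of_generators hL (by simp) h hg)
  · exact hinv (commutator_mem_of_generators hL (hinv h) (by simp) hg)

/-- Since `b² = (a, a)` and `a = (1, b)`, the commutator of `b²` and `a` is `(1, ⁅a, b⁆)`, and `⁅a,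
b⁆` normally generates `D1`. -/
theorem incl_mem_D1 (e : Bool) {x : Aut} (hx : x ∈ D1) : incl e x ∈ D1 := by
  have hD : ∀ g ∈ Basilica, ∀ x ∈ D1, g * x * g⁻¹ ∈ D1 := fun g hg x => conj_mem_D1 hg
  have h : D1 ≤ D1.comap (incl true) := by
    refine D1_le_of_commutator_mem (fun g hg x => incl_true_conj_mem hD hg) ?_
    have : ⁅incl true a * incl false a, incl true b * 1⁆ ∈ D1 := by
      rw [← (commute_incl (by simp) _ _).eq, ← b_sq, mul_one, ← a_eq]
      exact Subgroup.commutator_mem_commutator (mul_mem b_mem b_mem) a_mem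
    rw [Subgroup.mem_comap, map_commutatorElement]
    rwa [commutator_mul_mul_of_commute (commute_incl (by simp) _ _) (Commute.one_right _)
      (Commute.one_left _)] at this
  cases e
  · exact (incl_false_mem_iff hD).2 (h hx)
  · exact h hx

theorem emb_mem_D1 (w : Vertex) {x : Aut} (hx : x ∈ D1) : emb w x ∈ D1 := by
  induction w with
  | nil => exact hx
  | cons e w ih => exact incl_mem_D1 e ih

theorem map_emb_D2_le (w : Vertex) : D2.map (emb w) ≤ D2 := by
  have : D1.map (emb w) ≤ D1 := Subgroup.map_le_iff_le_comap.2 fun x hx => emb_mem_D1 w hx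
  rw [D2, Subgroup.map_commutator]
  exact Subgroup.commutator_mono this this

end BinaryTree

-- Noetherian quotients of the Basilica group

namespace BinaryTree

open Subgroup

theorem conj_mem_zpowers_sup {L : Subgroup Aut} (hL : ∀ g ∈ Basilica, ∀ y ∈ L, g * y * g⁻¹ ∈ L)
    {x : Aut} (hx : ∀ g ∈ Basilica, ⁅g, x⁆ ∈ L) :
    ∀ g ∈ Basilica, ∀ y ∈ zpowers x ⊔ L, g * y * g⁻¹ ∈ zpowers x ⊔ L := by
  intro g hg y hy
  have : (zpowers x ⊔ L).map (MulAut.conj g).toMonoidHom ≤ zpowers x ⊔ L := by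
    rw [Subgroup.map_sup, MonoidHom.map_zpowers]
    refine sup_le (zpowers_le.2 ?_) (map_le_iff_le_comap.2 fun y hy =>
      le_sup_right (a := zpowers x) (hL g hg y hy))
    have : g * x * g⁻¹ = ⁅g, x⁆ * x := by rw [commutatorElement_def, inv_mul_cancel_right]
    change g * x * g⁻¹ ∈ _
    rw [this]
    exact mul_mem (le_sup_right (a := zpowers x) (hx g hg))
      (le_sup_left (a := zpowers x) (mem_zpowers x))
  exact this ⟨y, hy, rfl⟩

/-- The product of `A` acting below `0` and `C` acting below `1`. -/
def prodSubgroup (A C : Subgroup Aut) : Subgroup Aut := A.map (incl false) ⊔ C.map (incl true)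

theorem prodSubgroup_mono {A A' C C' : Subgroup Aut} (h : A ≤ A') (h' : C ≤ C') :
    prodSubgroup A C ≤ prodSubgroup A' C' :=
  sup_le_sup (map_mono h) (map_mono h')

theorem map_incl_le_normalizer {d e : Bool} (h : d ≠ e) (A C : Subgroup Aut) :
    A.map (incl d) ≤ normalizer (C.map (incl e) : Set Aut) := by
  rintro _ ⟨x, -, rfl⟩
  rw [mem_normalizer_iff]
  have key : ∀ (z y : Aut), y ∈ C.map (incl e) → incl d z * y * (incl d z)⁻¹ = y := by
    rintro z _ ⟨y, -, rfl⟩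
    rw [(commute_incl h z y).eq, mul_inv_cancel_right]
  refine fun y => ⟨fun hy => (key x y hy).symm ▸ hy, fun hy => ?_⟩
  have := key x⁻¹ _ hy
  rw [map_inv] at this
  rw [← this] at hy
  convert hy using 1
  group

theorem mem_prodSubgroup {A C : Subgroup Aut} {g : Aut} :
    g ∈ prodSubgroup A C ↔ ∃ x ∈ A, ∃ y ∈ C, incl false x * incl true y = g := by
  rw [prodSubgroup, mem_sup_of_le_normalizer (map_incl_le_normalizer (by simp) A C)]
  constructor
  · rintro ⟨_, ⟨x, hx, rfl⟩, _, ⟨y, hy, rfl⟩, h⟩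
    exact ⟨x, hx, y, hy, h⟩
  · rintro ⟨x, hx, y, hy, h⟩
    exact ⟨_, ⟨x, hx, rfl⟩, _, ⟨y, hy, rfl⟩, h⟩

theorem prodSubgroup_le_normalizer {A A' C C' : Subgroup Aut}
    (h : A ≤ normalizer (A' : Set Aut)) (h' : C ≤ normalizer (C' : Set Aut)) :
    prodSubgroup A C ≤ normalizer (prodSubgroup A' C' : Set Aut) := by
  have key : ∀ {A A' : Subgroup Aut} (e : Bool), A ≤ normalizer (A' : Set Aut) →
      A.map (incl e) ≤ normalizer (A'.map (incl e) : Set Aut) := fun e h =>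
    (map_mono h).trans (le_normalizer_map _)
  refine sup_le ?_ ?_
  · exact (le_inf (key _ h) (map_incl_le_normalizer (by simp) _ _)).trans
      (normalizer_inf_normalizer_le_normalizer_sup _ _)
  · exact (le_inf (map_incl_le_normalizer (by simp) _ _) (key _ h')).trans
      (normalizer_inf_normalizer_le_normalizer_sup _ _)

theorem b_mem_normalizer_prodSubgroup {L : Subgroup Aut} (h : a ∈ normalizer (L : Set Aut)) :
    b ∈ normalizer (prodSubgroup L L : Set Aut) := by
  rw [mem_normalizer_iff] at h ⊢
  intro g
  constructor
  · intro hg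
    obtain ⟨x, hx, y, hy, rfl⟩ := mem_prodSubgroup.1 hg
    refine mem_prodSubgroup.2 ⟨a * y * a⁻¹, (h y).1 hy, x, hx, ?_⟩
    rw [(commute_incl (by simp) _ _).eq, ← b_conj_incl_true, ← b_conj_incl_false]
    group
  · intro hg
    obtain ⟨x, hx, y, hy, hxy⟩ := mem_prodSubgroup.1 hg
    have hx' : a * (a⁻¹ * x * a) * a⁻¹ = x := by group
    refine mem_prodSubgroup.2 ⟨y, hy, a⁻¹ * x * a, (h _).2 (hx'.symm ▸ hx), ?_⟩
    refine mul_left_cancel (a := b) (mul_right_cancel (b := b⁻¹) ?_)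
    rw [← hxy, (commute_incl (by simp) x y).eq]
    conv_rhs => rw [← hx', ← b_conj_incl_true, ← b_conj_incl_false]
    group

theorem Basilica_le_zpowers_sup :
    Basilica ≤ zpowers b ⊔ prodSubgroup Basilica Basilica := by
  refine Basilica_le ?_ (le_sup_left (a := zpowers b) (mem_zpowers b))
  refine le_sup_right (a := zpowers b) (le_sup_right (a := Basilica.map (incl false)) ?_)
  exact ⟨b, b_mem, a_eq.symm⟩

theorem Basilica_le_normalizer_prodSubgroup {L : Subgroup Aut}
    (h : Basilica ≤ normalizer (L : Set Aut)) :
    Basilica ≤ normalizer (prodSubgroup L L : Set Aut) :=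
  Basilica_le_zpowers_sup.trans (sup_le (zpowers_le.2 (b_mem_normalizer_prodSubgroup (h a_mem)))
    (prodSubgroup_le_normalizer h h))

/-- Climb from `L × L` through `Basilica × L` and `Basilica × Basilica` to the extension of the
latter by `⟨b⟩`. These are taken in `Aut`; it suffices that the last one contains the Basilica
group. -/
theorem relNoetherian_prodSubgroup {L : Subgroup Aut} (hLB : L ≤ Basilica)
    (hL : Basilica ≤ normalizer (L : Set Aut)) (h : RelNoetherian Basilica L) :
    RelNoetherian Basilica (prodSubgroup L L) := by
  have h1 : RelNoetherian (prodSubgroup Basilica L) (prodSubgroup L L) :=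
    (h.map hLB (incl false)).sup (map_incl_le_normalizer (by simp) _ _) (map_mono hLB)
  have h2 : RelNoetherian (prodSubgroup Basilica Basilica) (prodSubgroup Basilica L) := by
    have := (h.map hLB (incl true)).sup (map_incl_le_normalizer (e := false) (by simp) _ Basilica)
      (map_mono hLB)
    rwa [sup_comm, sup_comm (L.map _)] at this
  have h3 := h2.trans h1 (prodSubgroup_mono le_rfl hLB) (prodSubgroup_mono hLB le_rfl)
    (prodSubgroup_le_normalizer le_normalizer hL)
  have hb := b_mem_normalizer_prodSubgroup (L := Basilica) (le_normalizer a_mem)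
  exact ((RelNoetherian.zpowers_sup hb).trans h3 le_sup_right (prodSubgroup_mono hLB hLB)
    (sup_le (zpowers_le.2 hb) le_normalizer)).mono Basilica_le_zpowers_sup le_rfl

/-- Modulo `M` the element `c` is central and generates the image of `D1`. Adjoining `c`, `b`, `a`
in turn therefore gives a chain of normal subgroups with cyclic steps from `M` to the whole group.
-/
theorem relNoetherian_comap_incl_D2 :
    RelNoetherian Basilica (Basilica ⊓ D2.comap (incl true)) := by
  set M := Basilica ⊓ D2.comap (incl true)
  have hM : ∀ g ∈ Basilica, ∀ x ∈ M, g * x * g⁻¹ ∈ M := fun g hg x hx =>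
    ⟨Basilica.mul_mem (Basilica.mul_mem hg hx.1) (Basilica.inv_mem hg),
      incl_true_conj_mem (fun g hg x => conj_mem_D2 hg) hg hx.2⟩
  -- Both `(1, c)` and `c = (b, b⁻¹)` lie in `D1`, and their commutator is `(1, ⁅c, b⁻¹⁆)`.
  have hcb : ⁅c, b⁻¹⁆ ∈ M := by
    refine ⟨D1_le (commutator_mem_commutator (D1_le c_mem) (inv_mem b_mem)), ?_⟩
    have hc : incl true b⁻¹ * incl false b = c := (commute_incl (by simp) _ _).eq
    have := commutator_mul_mul_of_commute (p := incl true c) (q := 1) (r := incl true b⁻¹)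
      (s := incl false b) (Commute.one_left _) (Commute.one_left _) (commute_incl (by simp) _ _)
    rw [mul_one, hc, ← map_commutatorElement] at this
    change incl true ⁅c, b⁻¹⁆ ∈ D2
    rw [← this]
    exact commutator_mem_commutator (incl_mem_D1 true c_mem) c_mem
  have hc : ∀ g ∈ Basilica, ⁅g, c⁆ ∈ M := by
    intro g hg
    rw [← commutatorElement_inv]
    refine inv_mem (commutator_mem_of_generators hM ?_ ?_ hg)
    · rw [commutatorElement_eq_one_iff_commute.2 a_commute_c.symm]
      exact one_mem _
    · convert hM b b_mem _ (inv_mem hcb) using 1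
      simp only [commutatorElement_def]
      group
  have hN1 := conj_mem_zpowers_sup hM hc
  set N1 := zpowers c ⊔ M
  have hMN1 : M ≤ N1 := le_sup_right
  have hD1 : D1 ≤ N1 := by
    refine D1_le_of_commutator_mem hN1 ?_
    -- Conjugating `c = a⁻¹ b⁻¹ a b` by `b a` gives `⁅a, b⁆`.
    convert hN1 _ (mul_mem b_mem a_mem) c (le_sup_left (a := zpowers c) (mem_zpowers c)) using 1
    rw [c_eq]
    simp only [commutatorElement_def]
    group
  have hN2 := conj_mem_zpowers_sup hN1 fun g hg => hD1 (commutator_mem_commutator hg b_mem)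
  have hN1B : N1 ≤ Basilica := sup_le (zpowers_le.2 (D1_le c_mem)) inf_le_left
  set N2 := zpowers b ⊔ N1
  have hN12 : N1 ≤ N2 := le_sup_right
  have hN2B : N2 ≤ Basilica := sup_le (zpowers_le.2 b_mem) hN1B
  have hN3B : zpowers a ⊔ N2 ≤ Basilica := sup_le (zpowers_le.2 a_mem) hN2B
  have h1 : RelNoetherian N1 M :=
    RelNoetherian.zpowers_sup (Basilica_le_normalizer hM (D1_le c_mem))
  have h2 : RelNoetherian N2 N1 := RelNoetherian.zpowers_sup (Basilica_le_normalizer hN1 b_mem)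
  have h3 : RelNoetherian (zpowers a ⊔ N2) N2 :=
    RelNoetherian.zpowers_sup (Basilica_le_normalizer hN2 a_mem)
  refine (h3.trans (h2.trans h1 hN12 hMN1 ?_) le_sup_right (hMN1.trans hN12) ?_).mono ?_ le_rfl
  · exact hN2B.trans (Basilica_le_normalizer hN1)
  · exact hN3B.trans (Basilica_le_normalizer hN2)
  · exact Basilica_le (le_sup_left (a := zpowers a) (mem_zpowers a))
      (le_sup_right (a := zpowers a) (le_sup_left (a := zpowers b) (mem_zpowers b)))

theorem relNoetherian_D2 : RelNoetherian Basilica D2 := by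
  have hM : ∀ g ∈ Basilica, ∀ x ∈ Basilica ⊓ D2.comap (incl true),
      g * x * g⁻¹ ∈ Basilica ⊓ D2.comap (incl true) := fun g hg x hx =>
    ⟨Basilica.mul_mem (Basilica.mul_mem hg hx.1) (Basilica.inv_mem hg),
      incl_true_conj_mem (fun g hg x => conj_mem_D2 hg) hg hx.2⟩
  refine (relNoetherian_prodSubgroup inf_le_left (Basilica_le_normalizer hM)
    relNoetherian_comap_incl_D2).mono le_rfl (sup_le ?_ ?_)
  · exact map_le_iff_le_comap.2 fun x hx =>
      (incl_false_mem_iff fun g hg x => conj_mem_D2 hg).2 hx.2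
  · exact map_le_iff_le_comap.2 inf_le_right

/-- The product of the copies of `D2` below the vertices of level `n`. -/
def levelD2 : ℕ → Subgroup Aut
  | 0 => D2
  | n + 1 => prodSubgroup (levelD2 n) (levelD2 n)

theorem levelD2_le (n : ℕ) : levelD2 n ≤ D2 := by
  induction n with
  | zero => exact le_rfl
  | succ n ih =>
    exact sup_le ((map_mono ih).trans (map_emb_D2_le [false]))
      ((map_mono ih).trans (map_emb_D2_le [true]))

theorem levelD2_le_Basilica (n : ℕ) : levelD2 n ≤ Basilica :=
  (levelD2_le n).trans (D2_le.trans D1_le)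

theorem Basilica_le_normalizer_levelD2 (n : ℕ) :
    Basilica ≤ normalizer (levelD2 n : Set Aut) := by
  induction n with
  | zero => exact Basilica_le_normalizer fun g hg x => conj_mem_D2 hg
  | succ n ih => exact Basilica_le_normalizer_prodSubgroup ih

theorem relNoetherian_levelD2 (n : ℕ) : RelNoetherian Basilica (levelD2 n) := by
  induction n with
  | zero => exact relNoetherian_D2
  | succ n ih =>
    exact relNoetherian_prodSubgroup (levelD2_le_Basilica n) (Basilica_le_normalizer_levelD2 n) ih

/-- Each coordinate of `g` at level `n` is either trivial or an element of `D2` whose copy lies in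
`H`. -/
theorem mem_of_mem_levelD2 {n : ℕ} {g : Aut} (hg : g ∈ levelD2 n) {H : Subgroup Aut}
    (h : ∀ w : Vertex, w.length = n → (∀ u, w <+: u → g u = u) ∨ D2.map (emb w) ≤ H) :
    g ∈ H := by
  induction n generalizing g H with
  | zero =>
    rcases h [] rfl with h | h
    · have : g = 1 := Aut.ext fun u => h u List.nil_prefix
      exact this ▸ one_mem H
    · exact h ⟨g, hg, rfl⟩
  | succ n ih =>
    obtain ⟨x, hx, y, hy, rfl⟩ := mem_prodSubgroup.1 hg
    refine mul_mem (ih (H := H.comap (incl false)) hx fun w hw => ?_)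
      (ih (H := H.comap (incl true)) hy fun w hw => ?_)
    · refine (h (false :: w) (by simp [hw])).imp (fun h u hu => ?_) fun h => ?_
      · simpa [incl_cons] using h (false :: u) (by simpa using hu)
      · rw [← map_le_iff_le_comap, map_map]
        exact h
    · refine (h (true :: w) (by simp [hw])).imp (fun h u hu => ?_) fun h => ?_
      · simpa [incl_cons] using h (true :: u) (by simpa using hu)
      · rw [← map_le_iff_le_comap, map_map]
        exact h

-- Countability of the candidate subgroups

instance : Countable Basilica := by
  have hrange := FreeGroup.range_lift_eq_closure (f := fun x : ({a, b} : Set Aut) => (x : Aut))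
  rw [Subtype.range_coe] at hrange
  have : Countable (FreeGroup ({a, b} : Set Aut)) := Quot.mk_surjective.countable
  exact (hrange ▸ (FreeGroup.lift _).rangeRestrict_surjective.countable :
    Countable (Subgroup.closure {a, b}))

/-- The subgroups which, for every vertex `w` of level `n`, contain the copy of `D2` below `w` or
fix all descendants of `w`. -/
def almostProduct (n : ℕ) : Set (Subgroup Basilica) :=
  {H | ∀ w : Vertex, w.length = n → (∀ h ∈ H.map Basilica.subtype, ∀ u, w <+: u → h u = u) ∨
    D2.map (emb w) ≤ H.map Basilica.subtype}

theorem countable_almostProduct (n : ℕ) : (almostProduct n).Countable := by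
  let F : Subgroup Basilica → Set Vertex × Subgroup Aut := fun H =>
    ({w | w.length = n ∧ ∀ h ∈ H.map Basilica.subtype, ∀ u, w <+: u → h u = u},
      H.map Basilica.subtype ⊔ levelD2 n)
  have hle : ∀ H : Subgroup Basilica, H.map Basilica.subtype ≤ Basilica := fun H =>
    map_subtype_le H
  have hmaps : Set.MapsTo F (almostProduct n)
      ({s : Set Vertex | s.Finite} ×ˢ {K : Subgroup Aut | levelD2 n ≤ K ∧ K ≤ Basilica}) := by
    intro H _
    refine ⟨?_, le_sup_right, sup_le (hle H) (levelD2_le_Basilica n)⟩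
    exact (List.finite_length_eq Bool n).subset fun w hw => hw.1
  refine hmaps.countable_of_injOn ?_
    (Set.Countable.ofPred_finite.prod ((relNoetherian_levelD2 n).countable_setOf
      (Set.countable_coe_iff.1 (inferInstanceAs (Countable Basilica)))))
  have key : ∀ H₁ ∈ almostProduct n, ∀ H₂ ∈ almostProduct n, F H₁ = F H₂ →
      H₁.map Basilica.subtype ≤ H₂.map Basilica.subtype := by
    intro H₁ h₁ H₂ h₂ heq h hh
    obtain ⟨e1, e2⟩ := Prod.ext_iff.1 heq
    simp only [F] at e1 e2
    have : h ∈ H₂.map Basilica.subtype ⊔ levelD2 n := e2.le (mem_sup_left hh)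
    obtain ⟨k, hk, l, hl, rfl⟩ := (mem_sup_of_le_normalizer
      ((hle H₂).trans (Basilica_le_normalizer_levelD2 n))).1 this
    -- Where `H₂` is trivial below `w`, so is `H₁` by equality of the first components. Then `k * l`
    -- and `k` are both trivial there, hence so is `l`.
    refine mul_mem hk (mem_of_mem_levelD2 hl fun w hw => ?_)
    refine (h₂ w hw).imp_left fun h' u hu => ?_
    have h1 := (e1.ge (show w ∈ _ from ⟨hw, h'⟩)).2 _ hh u hu
    rw [mul_apply] at h1
    exact apply_injective k (h1.trans (h' k hk u hu).symm)
  intro H₁ h₁ H₂ h₂ heq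
  exact map_injective Basilica.subtype_injective
    (le_antisymm (key H₁ h₁ H₂ h₂ heq) (key H₂ h₂ H₁ h₁ heq.symm))

end BinaryTree

-- Copies of `D2` inside almost every subgroup

namespace BinaryTree

open Subgroup

theorem apply_ne_of_prefix {g h : Aut} {u v : Vertex} (huv : u <+: v) (hu : g u ≠ h u) :
    g v ≠ h v := fun he => hu <| eq_of_prefix_of_prefix (prefix_apply g huv)
  (he ▸ prefix_apply h huv) (by simp)

/-- The element `c = (b, b⁻¹)` moves all four vertices of level two. -/
theorem emb_c_apply_ne (x : Boundary) (n : ℕ) :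
    emb (prefixAt x n) c (prefixAt x (n + 2)) ≠ prefixAt x (n + 2) := by
  obtain ⟨t, ht⟩ := prefixAt_prefix x (Nat.le_add_right n 2)
  have hl : t.length = 2 := by
    have := congrArg List.length ht
    simpa [length_prefixAt] using this
  obtain ⟨d, e, rfl⟩ := List.length_eq_two.1 hl
  rw [← ht, emb_apply_append, Ne, List.append_right_inj]
  cases d <;> cases e <;> decide

/-- A finite index subgroup of `D1`, acting below a vertex of the ray `x`, moves `x` to infinitely
many rays. -/
theorem exists_three_images (P : Subgroup D1) [P.FiniteIndex] (x : Boundary) (n : ℕ) :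
    ∃ m, n ≤ m ∧ ∃ p ∈ P, ∃ q ∈ P,
      emb (prefixAt x n) (p : Aut) (prefixAt x m) ≠ prefixAt x m ∧
      emb (prefixAt x n) (q : Aut) (prefixAt x m) ≠ prefixAt x m ∧
      emb (prefixAt x n) (p : Aut) (prefixAt x m) ≠
        emb (prefixAt x n) (q : Aut) (prefixAt x m) := by
  have hy : ∀ i, ∃ y, prefixAt x n ++ y = prefixAt x (n + 2 * i) := fun i =>
    prefixAt_prefix x (Nat.le_add_right _ _)
  choose y hy using hy
  -- The copy of `c` placed at level `n + 2 * i` of the ray fixes that level and moves the ray's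
  -- vertex two levels down, so different indices give different images. By pigeonhole, three of
  -- them lie in one coset of `P`.
  let g : ℕ → D1 := fun i => ⟨emb (y i) c, emb_mem_D1 (y i) c_mem⟩
  have hg : ∀ i, emb (prefixAt x n) (g i : Aut) = emb (prefixAt x (n + 2 * i)) c := fun i => by
    rw [← hy, emb_append]
  have hne : ∀ i j m, i < j → n + 2 * i + 2 ≤ m →
      emb (prefixAt x n) (g j : Aut) (prefixAt x m) ≠
        emb (prefixAt x n) (g i : Aut) (prefixAt x m) := by
    intro i j m hij hm
    refine (apply_ne_of_prefix (prefixAt_prefix x hm) ?_).symm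
    rw [hg, hg, apply_of_length_le (emb_mem_supportedBelow _ _)
      (by simp only [length_prefixAt]; omega : (prefixAt x (n + 2 * i + 2)).length ≤
        (prefixAt x (n + 2 * j)).length)]
    exact emb_c_apply_ne x _
  obtain ⟨q, hq⟩ := Finite.exists_infinite_fiber fun i => (g i : D1 ⧸ P)
  rw [Set.infinite_coe_iff] at hq
  obtain ⟨i, hi⟩ := hq.nonempty
  obtain ⟨j, hj, hij⟩ := hq.exists_gt i
  obtain ⟨k, hk, hjk⟩ := hq.exists_gt j
  refine ⟨n + 2 * j + 2, by omega, (g i)⁻¹ * g j, QuotientGroup.eq.1 (hi.trans hj.symm),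
    (g i)⁻¹ * g k, QuotientGroup.eq.1 (hi.trans hk.symm), ?_, ?_, ?_⟩
  · intro h
    refine hne i j (n + 2 * j + 2) hij (by omega) ?_
    conv_rhs => rw [← h]
    rw [← mul_apply, ← map_mul, coe_mul, coe_inv, mul_inv_cancel_left]
  · intro h
    refine hne i k (n + 2 * j + 2) (hij.trans hjk) (by omega) ?_
    conv_rhs => rw [← h]
    rw [← mul_apply, ← map_mul, coe_mul, coe_inv, mul_inv_cancel_left]
  · intro h
    refine hne j k (n + 2 * j + 2) hjk (by omega) ?_
    simp only [coe_mul, map_mul] at h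
    exact (apply_injective _ h).symm

/-- For every vertex `w` moved by an element `γ` of `H`, the projection of the intersection of `H`
with the product of the copies of `D1` below `w` and `γ w` has finite index in `D1`. -/
def HasLargeProjections (H : Subgroup Aut) : Prop :=
  ∀ (w : Vertex) (γ : Aut), γ ∈ H → γ w ≠ w → ∃ P : Subgroup D1, P.FiniteIndex ∧
    ∀ p ∈ P, ∃ q : D1, emb w (p : Aut) * (γ * emb w (q : Aut) * γ⁻¹) ∈ H

/-- A commutator of two elements of `H` loses its unwanted factors when these are supported below
distinct vertices. A first round, with `γ` and a second element `h`, puts the commutators of a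
finite index subgroup `N` into `H`; a second round, inside `N`, yields all of `D2` lower down. -/
theorem HasLargeProjections.exists_map_emb_D2_le {H : Subgroup Aut} (hH : HasLargeProjections H)
    {γ : Aut} (hγ : γ ∈ H) {x : Boundary} {n : ℕ} (hx : γ (prefixAt x n) ≠ prefixAt x n) :
    ∃ m, D2.map (emb (prefixAt x m)) ≤ H := by
  obtain ⟨P, _, hP⟩ := hH _ γ hγ hx
  obtain ⟨m, hm, p, hp, -, -, hpx, -⟩ := exists_three_images P x n
  obtain ⟨q, hq⟩ := hP p hp
  have hwz := prefixAt_prefix x hm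
  set w := prefixAt x n
  set z := prefixAt x m
  -- This element of `H` fixes `w`, which `γ` moves, and moves `z` as `p` does. Hence `z`, `γ z` and
  -- `h z` are distinct.
  set h := emb w (p : Aut) * (γ * emb w (q : Aut) * γ⁻¹)
  have hγz : γ z ≠ z := apply_ne_of_prefix (h := 1) hwz hx
  have hhz : h z = emb w (p : Aut) z := by
    change emb w (p : Aut) ((γ * emb w (q : Aut) * γ⁻¹) z) = _
    rw [conj_mem_supportedBelow (emb_mem_supportedBelow w _) γ z fun h' =>
      hx (eq_of_prefix_of_prefix h' hwz (by simp))]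
  have hγh : γ z ≠ h z := by
    refine apply_ne_of_prefix hwz ?_
    have : h w = w := by
      change emb w (p : Aut) ((γ * emb w (q : Aut) * γ⁻¹) w) = _
      rw [apply_of_length_le (conj_mem_supportedBelow (emb_mem_supportedBelow w _) γ) (by simp),
        apply_of_length_le (emb_mem_supportedBelow w _) le_rfl]
    rwa [this]
  have hhz' : h z ≠ z := hhz ▸ hpx
  obtain ⟨P₁, _, hP₁⟩ := hH z γ hγ hγz
  obtain ⟨P₂, _, hP₂⟩ := hH z h hq hhz'
  -- Normality will put `⁅t, k⁆` in `N` for every `t` in `D1` and `k` in `N`.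
  set N := (P₁ ⊓ P₂).normalCore
  have hN₁ : N ≤ P₁ := (normalCore_le _).trans inf_le_left
  have hN₂ : N ≤ P₂ := (normalCore_le _).trans inf_le_right
  have hcomm : ∀ r ∈ N, ∀ s ∈ N, emb z ((⁅r, s⁆ : D1) : Aut) ∈ H := by
    intro r hr s hs
    obtain ⟨r', hr'⟩ := hP₁ r (hN₁ hr)
    obtain ⟨s', hs'⟩ := hP₂ s (hN₂ hs)
    have h0 := fun (g : Aut) => emb_mem_supportedBelow z g
    have := H.commutator_le_self (commutator_mem_commutator hr' hs')
    rw [commutator_mul_mul_of_commute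
      (commute_of_supportedBelow (by simp) hγz (conj_mem_supportedBelow (h0 _) γ) (h0 _))
      (commute_of_supportedBelow (by simp) hγh (conj_mem_supportedBelow (h0 _) γ)
        (conj_mem_supportedBelow (h0 _) h))
      (commute_of_supportedBelow (by simp) hhz' (conj_mem_supportedBelow (h0 _) h) (h0 _)),
      ← map_commutatorElement] at this
    exact this
  obtain ⟨m', hm', k, hk, l, hl, hkx, hlx, hkl⟩ := exists_three_images N x m
  refine ⟨m', ?_⟩
  obtain ⟨y, hy⟩ := prefixAt_prefix x hm'
  set z' := prefixAt x m'
  rw [D2, map_commutator, commutator_le]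
  rintro _ ⟨r, hr, rfl⟩ _ ⟨s, hs, rfl⟩
  let r' : D1 := ⟨emb y r, emb_mem_D1 y hr⟩
  let s' : D1 := ⟨emb y s, emb_mem_D1 y hs⟩
  have hmem : ∀ (t : D1), ∀ k ∈ N, ⁅t, k⁆ ∈ N := fun t k hk => by
    rw [commutatorElement_def]
    exact N.mul_mem (normalCore_normal _ |>.conj_mem k hk t) (N.inv_mem hk)
  have key := hcomm _ (hmem r' k hk) _ (hmem s' l hl)
  -- Each such commutator is `t` below `z'` times a copy of `t⁻¹` below the image of `z'` under `k`.
  -- Since `k` and `l` send `z'` to distinct vertices other than `z'`, only `⁅r, s⁆` below `z'`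
  -- survives.
  have hform : ∀ (t : Aut) (ht : emb y t ∈ D1) (k : D1),
      emb z ((⁅(⟨emb y t, ht⟩ : D1), k⁆ : D1) : Aut) =
        emb z' t * (emb z (k : Aut) * emb z' t⁻¹ * (emb z (k : Aut))⁻¹) := fun t ht k => by
    change emb z (⁅emb y t, (k : Aut)⁆) = _
    rw [← hy, emb_append, emb_append, commutatorElement_def]
    simp only [map_mul, map_inv, mul_assoc]
    rfl
  have h0 := fun (g : Aut) => emb_mem_supportedBelow z' g
  change emb z ⁅((⁅r', k⁆ : D1) : Aut), ((⁅s', l⁆ : D1) : Aut)⁆ ∈ H at key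
  rwa [map_commutatorElement, hform, hform, commutator_mul_mul_of_commute
    (commute_of_supportedBelow (by simp) hkx (conj_mem_supportedBelow (h0 _) _) (h0 _))
    (commute_of_supportedBelow (by simp) hkl (conj_mem_supportedBelow (h0 _) _)
      (conj_mem_supportedBelow (h0 _) _))
    (commute_of_supportedBelow (by simp) hlx (conj_mem_supportedBelow (h0 _) _) (h0 _))] at key

instance : Countable D1 := (inclusion_injective D1_le).countable

theorem ae_hasLargeProjections {μ : Measure (Subgroup Basilica)} (hμ : IsIRS μ) :
    ∀ᵐ H ∂μ, HasLargeProjections (H.map Basilica.subtype) := by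
  let e : Vertex → D1 →* Basilica := fun w =>
    ((emb w).comp D1.subtype).codRestrict Basilica fun p => D1_le (emb_mem_D1 w p.2)
  have key : ∀ (w : Vertex) (γ : Basilica), ∀ᵐ H ∂μ, γ ∈ H → (γ : Aut) w ≠ w →
      ∃ P : Subgroup D1, P.FiniteIndex ∧ ∀ p ∈ P, ∃ q : D1, e w p * (γ * e w q * γ⁻¹) ∈ H := by
    intro w γ
    by_cases hw : (γ : Aut) w = w
    · exact Filter.Eventually.of_forall fun H _ h => absurd hw h
    have hcomm : ∀ p q, Commute (e w p) (((MulAut.conj γ).toMonoidHom.comp (e w)) q) := by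
      intro p q
      refine Subtype.ext (commute_of_supportedBelow (v := w) (w := (γ : Aut) w) (by simp)
        (Ne.symm hw) (emb_mem_supportedBelow w (p : Aut))
        (conj_mem_supportedBelow (emb_mem_supportedBelow w (q : Aut)) (γ : Aut))).eq
    filter_upwards [ae_finiteIndex_pairedProjection hμ (e w) γ hcomm] with H hH hγ _
    exact ⟨_, hH hγ, fun p hp => mem_pairedProjection.1 hp⟩
  filter_upwards [ae_all_iff.2 fun w => ae_all_iff.2 (key w)] with H hH
  rintro w _ ⟨γ, hγ, rfl⟩ hw
  obtain ⟨P, hP, hPH⟩ := hH w γ hγ hw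
  refine ⟨P, hP, fun p hp => ?_⟩
  obtain ⟨q, hq⟩ := hPH p hp
  exact ⟨q, _, hq, rfl⟩

-- Compactness of the boundary

theorem exists_prefixAt_eq (u : Vertex) : ∃ x : Boundary, prefixAt x u.length = u := by
  refine ⟨fun i => u[i]?.getD false, List.ext_getElem (by simp [length_prefixAt]) fun i h _ => ?_⟩
  simp [prefixAt]

theorem prefixAt_eq_of_mem_cylinder {x y : Boundary} {n : ℕ}
    (h : y ∈ PiNat.cylinder x n) : prefixAt y n = prefixAt x n := by
  simp only [prefixAt]
  congr 1
  funext i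
  exact h i i.2

theorem mem_cylinder_of_prefix {x y : Boundary} {n m : ℕ} (h : prefixAt x n <+: prefixAt y m) :
    y ∈ PiNat.cylinder x n := by
  intro i hi
  have h1 := List.prefix_iff_getElem?.1 h i (by rwa [length_prefixAt])
  have hm : n ≤ m := by simpa [length_prefixAt] using h.length_le
  rw [getElem?_prefixAt y (hi.trans_le hm)] at h1
  simpa [prefixAt] using h1

/-- A property of vertices which passes to descendants and holds somewhere on each ray holds for
all vertices of some level. -/
theorem exists_level_forall {Q : Vertex → Prop} (hQ : ∀ u v, u <+: v → Q u → Q v)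
    (h : ∀ x : Boundary, ∃ n, Q (prefixAt x n)) : ∃ n, ∀ w : Vertex, w.length = n → Q w := by
  choose n hn using h
  obtain ⟨t, -, ht⟩ := (isCompact_univ (X := Boundary)).elim_nhds_subcover
    (fun x => PiNat.cylinder x (n x)) fun x _ =>
      (PiNat.isOpen_cylinder _ x (n x)).mem_nhds (PiNat.self_mem_cylinder x (n x))
  refine ⟨t.sup n, fun w hw => ?_⟩
  obtain ⟨y, hy⟩ := exists_prefixAt_eq w
  obtain ⟨x, hx, hxy⟩ := Set.mem_iUnion₂.1 (ht (Set.mem_univ y))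
  refine hQ (prefixAt x (n x)) w ?_ (hn x)
  rw [← prefixAt_eq_of_mem_cylinder hxy, ← hy, hw]
  exact prefixAt_prefix y (Finset.le_sup hx)

/-- A fixed ray has a neighbouring cylinder of fixed rays, so `H` is trivial below one of its
vertices. A moved ray has a vertex below which `H` contains `D2`. Both alternatives pass to
descendants. -/
theorem mem_almostProduct_of_isOpen {H : Subgroup Basilica} (hfix : IsOpen (boundaryFix H))
    (hH : HasLargeProjections (H.map Basilica.subtype)) : ∃ n, H ∈ almostProduct n := by
  refine exists_level_forall (fun u v huv hu => ?_) fun x => ?_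
  · refine hu.imp (fun h g hg t ht => h g hg t (huv.trans ht)) fun h => ?_
    obtain ⟨t, rfl⟩ := huv
    refine le_trans ?_ h
    have : emb (u ++ t) = (emb u).comp (emb t) := MonoidHom.ext fun g => emb_append u t g
    rw [this, ← map_map]
    exact map_mono (map_emb_D2_le t)
  · by_cases hx : x ∈ boundaryFix H
    · obtain ⟨_, ⟨y, n, rfl⟩, hxy, hsub⟩ :=
        (PiNat.isTopologicalBasis_cylinders _).exists_subset_of_mem_open hx hfix
      refine ⟨n, Or.inl ?_⟩
      rintro _ ⟨g, hg, rfl⟩ u hu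
      obtain ⟨z, hz⟩ := exists_prefixAt_eq u
      rw [← hz, prefixAt_eq_of_mem_cylinder hxy] at hu
      have hgz : rayMap (g : Aut) z = z := hsub (mem_cylinder_of_prefix hu) g hg
      have := prefixAt_rayMap (g : Aut) z u.length
      rw [hgz, hz] at this
      exact this.symm
    · simp only [boundaryFix, Set.mem_ofPred_eq, not_forall] at hx
      obtain ⟨g, hg, hgx⟩ := hx
      have : ∃ n, (g : Aut) (prefixAt x n) ≠ prefixAt x n := by
        by_contra! hcon
        exact hgx (ext_prefixAt fun n => (prefixAt_rayMap (g : Aut) x n).trans (hcon n))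
      obtain ⟨n, hn⟩ := this
      obtain ⟨m, hm⟩ := hH.exists_map_emb_D2_le ⟨g, hg, rfl⟩ hn
      exact ⟨m, Or.inr hm⟩

end BinaryTree

theorem mainTheorem10 (μ : Measure (Subgroup BinaryTree.Basilica)) (hμ : IsErgodicIRS μ)
    (hfix : ∀ᵐ H ∂μ, IsClopen (BinaryTree.boundaryFix H)) :
    IsAtomicMeasure μ := by
  refine ⟨⋃ n, BinaryTree.almostProduct n,
    Set.countable_iUnion BinaryTree.countable_almostProduct, ?_⟩
  rw [← mem_ae_iff]
  filter_upwards [hfix, BinaryTree.ae_hasLargeProjections hμ.toIsIRS] with H h1 h2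
  exact Set.mem_iUnion.2 (BinaryTree.mem_almostProduct_of_isOpen h1.isOpen h2)
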